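/- **Language.** The monadic second-order language of order has only set variables. Its atomic formulas are $X\subseteq Y$, "$X$ is a singleton", and $X<Y$ (meaning $X=\{x\}$, $Y=\{y\}$ and $x<y$ for some $x,y$). Formulas are built from these with Boolean connectives and quantifiers over set variables. In a linear order $C$ the set variables range over all subsets of $C$. **Uniformization property.** Let $C$ be a linear order, let $\bar P=(P_0,\dots,P_{l-1})$ be a finite tuple of subsets of $C$ (parameters), and let $\varphi(X,Y,\bar P)$ be a formula of this language. - $\varphi(X,Y,\bar P)$ is *potentially uniformizable* in $C$ if $C\models(\forall Y)(\exists X)\,\varphi(X,Y,\bar P)$. - A formula $\psi(X,Y,\bar Q)$, with a finite tuple $\bar Q$ of subsets of $C$ as parameters, *uniformizes* $\varphi(X,Y,\bar P)$ in $C$ if $C\models(\forall Y)(\exists! X)\,\psi(X,Y,\bar Q)$ and $C\models(\forall X)(\forall Y)\,[\psi(X,Y,\bar Q)\rightarrow\varphi(X,Y,\bar P)]$. - $C$ has the *uniformization property* if every formula with parameters that is potentially uniformizable in $C$ is uniformized in $C$ by some formula with parameters. **Proposition 6.1.** Let $\alpha$ and $\beta$ be ordinals which, as linear orders, have the uniformization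 property. Then the ordinals $\alpha+\beta$ and $\alpha\cdot\beta$ (the sum of $\beta$ copies of $\alpha$) also have the uniformization property. -/

import Mathlib

universe u

namespace MonadicOrder

/-- Formulas of the monadic second-order language of order whose free variables are the `n` set
variables `X_0, …, X_{n-1}`. As usual for this language, all variables are set variables, and
elements are represented by singletons. -/
inductive Formula : ℕ → Type
  /-- `X_i ⊆ X_j` (for a singleton `X_i = {x}` this is the membership `x ∈ X_j`) -/
  | sub {n : ℕ} (i j : Fin n) : Formula n
  /-- `X_i` is a singleton -/
  | sing {n : ℕ} (i : Fin n) : Formula n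
  /-- `X_i = {x}` and `X_j = {y}` with `x < y` -/
  | lt {n : ℕ} (i j : Fin n) : Formula n
  | neg {n : ℕ} (φ : Formula n) : Formula n
  | and {n : ℕ} (φ ψ : Formula n) : Formula n
  /-- Quantification over one set; the bound variable is `X_0` of the body, and the variable `X_i`
  of the quantified formula is `X_{i+1}` in the body. -/
  | ex {n : ℕ} (φ : Formula (n + 1)) : Formula n

variable {C : Type u} [PartialOrder C]

/-- `φ.Holds v` is the satisfaction relation `C ⊨ φ(v_0, …, v_{n-1})`; the set quantifier ranges
over all subsets of `C`. -/
def Formula.Holds : {n : ℕ} → Formula n → (Fin n → Set C) → Prop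
  | _, .sub i j, v => v i ⊆ v j
  | _, .sing i, v => ∃ x, v i = {x}
  | _, .lt i j, v => ∃ x y, v i = {x} ∧ v j = {y} ∧ x < y
  | _, .neg φ, v => ¬ φ.Holds v
  | _, .and φ ψ, v => φ.Holds v ∧ ψ.Holds v
  | _, .ex φ, v => ∃ A : Set C, φ.Holds (Fin.cons A v : Fin _ → Set C)

/-- `C ⊨ φ(X, Y, P_0, …, P_{l-1})`. -/
def Formula.HoldsAt {l : ℕ} (φ : Formula (l + 2)) (X Y : Set C) (P : Fin l → Set C) : Prop :=
  φ.Holds (Fin.cons X (Fin.cons Y P : Fin (l + 1) → Set C) : Fin (l + 2) → Set C)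

/-- `φ(X, Y, P)` is potentially uniformizable in `C`: `C ⊨ ∀ Y ∃ X φ(X, Y, P)`. -/
def PotentiallyUniformizable {l : ℕ} (φ : Formula (l + 2)) (P : Fin l → Set C) : Prop :=
  ∀ Y : Set C, ∃ X : Set C, φ.HoldsAt X Y P

/-- `ψ(X, Y, Q)` uniformizes `φ(X, Y, P)` in `C`: it implies `φ(X, Y, P)`, and for every `Y` it is
satisfied by exactly one `X`. -/
def Uniformizes {k l : ℕ} (ψ : Formula (k + 2)) (Q : Fin k → Set C)
    (φ : Formula (l + 2)) (P : Fin l → Set C) : Prop :=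
  (∀ Y : Set C, ∃! X : Set C, ψ.HoldsAt X Y Q) ∧
    ∀ X Y : Set C, ψ.HoldsAt X Y Q → φ.HoldsAt X Y P

variable (C) in
/-- `C` has the uniformization property: every formula with parameters that is potentially
uniformizable in `C` is uniformized in `C` by some formula with parameters. -/
def HasUniformizationProperty : Prop :=
  ∀ (l : ℕ) (φ : Formula (l + 2)) (P : Fin l → Set C), PotentiallyUniformizable φ P →
    ∃ (k : ℕ) (ψ : Formula (k + 2)) (Q : Fin k → Set C), Uniformizes ψ Q φ P

end MonadicOrder

namespace MonadicOrder

/-! Both operations are sums of orders over an index order: a sum over the two-element order for `α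
+ β`, and a sum of copies of `α` over `β` for `α * β`. The engine is the composition method. By
`Definable.decomposable`, a relation definable in a sum depends only on the index sets where
finitely many formulas hold in the summands, through a relation definable in the index order.
Conversely, when every summand has a least element, `IsLexSum.definable_comp` turns such a
description back into a formula of the sum, the indices being represented by the least elements.

`Unif.lexSum` then uniformizes in two stages. In the index order, select which pattern of formulas
each summand should realize, among the patterns that it can realize for the given `Y`. In each
summand, select a set realizing its pattern. Gluing gives the unique definable `X`. The first stage
selects a tuple of index sets from a tuple, and the second needs one formula for all summands.

For a finite index order the first stage is free, as is merging separate formulas for the summands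
(`unif_of_finite`, `unif_of_forall`), which settles the sum. For the product, both stages need
uniformization of tuples in `α` and `β`, while the hypotheses concern single sets. A tuple of
subsets of `β` is coded by one subset of `(k + 1) * β`, and this ordinal is `β` plus a finite
ordinal, so the sum case applies to it (`HasUniformizationProperty.unif_tuple`).

Definability is formulated for families: one formula serves every member, while the parameters may
differ from member to member. -/

/-- A family `R a` of relations between `ι`-indexed sets and `κ`-indexed points of the orders `C a`
is definable if there are finitely many parameters in each `C a` and one monadic formula that
defines all the `R a`. A formula is supplied for every way to assign variables to the arguments. -/
def Definable {A : Type*} (C : A → Type*) [∀ a, PartialOrder (C a)] {ι κ : Type}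
    (R : ∀ a, (ι → Set (C a)) → (κ → C a) → Prop) : Prop :=
  ∃ (ρ : Type) (_ : Finite ρ) (P : ∀ a, ρ → Set (C a)),
    ∀ (n : ℕ) (f : ι → Fin n) (g : κ → Fin n) (h : ρ → Fin n), ∃ φ : Formula n,
      ∀ (a : A) (v : Fin n → Set (C a)) (x : κ → C a), (∀ k, v (g k) = {x k}) →
        (∀ r, v (h r) = P a r) → (φ.Holds v ↔ R a (fun i => v (f i)) x)

/-! ### Closure of definable families under logical operations -/

section Closure

variable {A : Type*} {C : A → Type*} [∀ a, PartialOrder (C a)] {ι κ : Type}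

theorem Definable.congr {R S : ∀ a, (ι → Set (C a)) → (κ → C a) → Prop} (h : Definable C R)
    (hRS : ∀ a v x, R a v x ↔ S a v x) : Definable C S := by
  have : R = S := by
    funext a v x
    exact propext (hRS a v x)
  exact this ▸ h

theorem definable_mem (k : κ) (i : ι) : Definable C fun _ v x => x k ∈ v i := by
  refine ⟨Empty, inferInstance, fun _ => Empty.elim, fun n f g _ => ⟨.sub (g k) (f i), ?_⟩⟩
  intro a v x hx _
  simp [Formula.Holds, hx]

theorem definable_lt (k l : κ) : Definable C fun a (_ : ι → Set (C a)) x => x k < x l := by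
  refine ⟨Empty, inferInstance, fun _ => Empty.elim, fun n f g _ => ⟨.lt (g k) (g l), ?_⟩⟩
  intro a v x hx _
  simp only [Formula.Holds, hx, Set.singleton_eq_singleton_iff]
  constructor
  · rintro ⟨_, _, rfl, rfl, h⟩
    exact h
  · intro h
    exact ⟨_, _, rfl, rfl, h⟩

theorem definable_eq (k l : κ) : Definable C fun _ (_ : ι → Set _) x => x k = x l := by
  refine ⟨Empty, inferInstance, fun _ => Empty.elim, fun n f g _ => ⟨.sub (g k) (g l), ?_⟩⟩
  intro a v x hx _
  simp [Formula.Holds, hx]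

theorem definable_subset (i j : ι) :
    Definable C fun a v (_ : κ → C a) => v i ⊆ v j :=
  ⟨Empty, inferInstance, fun _ => Empty.elim, fun _ f _ _ =>
    ⟨.sub (f i) (f j), fun _ _ _ _ _ => Iff.rfl⟩⟩

theorem definable_sing (i : ι) :
    Definable C fun a v (_ : κ → C a) => ∃ y, v i = {y} :=
  ⟨Empty, inferInstance, fun _ => Empty.elim, fun _ f _ _ =>
    ⟨.sing (f i), fun _ _ _ _ _ => Iff.rfl⟩⟩

theorem definable_sing_lt (i j : ι) :
    Definable C fun a v (_ : κ → C a) => ∃ y z, v i = {y} ∧ v j = {z} ∧ y < z :=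
  ⟨Empty, inferInstance, fun _ => Empty.elim, fun _ f _ _ =>
    ⟨.lt (f i) (f j), fun _ _ _ _ _ => Iff.rfl⟩⟩

theorem definable_true : Definable C fun _ (_ : ι → Set _) (_ : κ → _) => True := by
  -- The quantifier supplies a variable even when `n = 0`.
  refine ⟨Empty, inferInstance, fun _ => Empty.elim, fun n f g _ => ⟨.ex (.sub 0 0), ?_⟩⟩
  intro a v x hx _
  simp [Formula.Holds]

theorem Definable.not {R : ∀ a, (ι → Set (C a)) → (κ → C a) → Prop} (h : Definable C R) :
    Definable C fun a v x => ¬ R a v x := by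
  obtain ⟨ρ, hρ, P, h⟩ := h
  refine ⟨ρ, hρ, P, fun n f g r => ?_⟩
  obtain ⟨φ, hφ⟩ := h n f g r
  exact ⟨.neg φ, fun a v x hx hP => not_congr (hφ a v x hx hP)⟩

theorem Definable.and {R S : ∀ a, (ι → Set (C a)) → (κ → C a) → Prop} (h : Definable C R)
    (h' : Definable C S) : Definable C fun a v x => R a v x ∧ S a v x := by
  obtain ⟨ρ, hρ, P, h⟩ := h
  obtain ⟨ρ', hρ', P', h'⟩ := h'
  refine ⟨ρ ⊕ ρ', inferInstance, fun a => Sum.elim (P a) (P' a), fun n f g r => ?_⟩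
  obtain ⟨φ, hφ⟩ := h n f g (fun s => r (.inl s))
  obtain ⟨φ', hφ'⟩ := h' n f g (fun s => r (.inr s))
  exact ⟨.and φ φ', fun a v x hx hP => and_congr (hφ a v x hx fun s => hP (.inl s))
    (hφ' a v x hx fun s => hP (.inr s))⟩

theorem Definable.or {R S : ∀ a, (ι → Set (C a)) → (κ → C a) → Prop} (h : Definable C R)
    (h' : Definable C S) : Definable C fun a v x => R a v x ∨ S a v x :=
  (h.not.and h'.not).not.congr fun _ _ _ => by tauto

theorem Definable.imp {R S : ∀ a, (ι → Set (C a)) → (κ → C a) → Prop} (h : Definable C R)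
    (h' : Definable C S) : Definable C fun a v x => R a v x → S a v x :=
  (h.not.or h').congr fun _ _ _ => by tauto

theorem Definable.iff {R S : ∀ a, (ι → Set (C a)) → (κ → C a) → Prop} (h : Definable C R)
    (h' : Definable C S) : Definable C fun a v x => (R a v x ↔ S a v x) :=
  ((h.imp h').and (h'.imp h)).congr fun _ _ _ => by tauto

theorem Definable.exSet {R : ∀ a, Set (C a) → (ι → Set (C a)) → (κ → C a) → Prop}
    (h : Definable C fun a (v : Option ι → Set (C a)) x =>
      R a (v none) (fun i => v (some i)) x) :
    Definable C fun a v x => ∃ B, R a B v x := by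
  obtain ⟨ρ, hρ, P, h⟩ := h
  refine ⟨ρ, hρ, P, fun n f g r => ?_⟩
  obtain ⟨φ, hφ⟩ := h (n + 1) (fun o => o.elim 0 fun i => (f i).succ) (fun k => (g k).succ)
    fun s => (r s).succ
  refine ⟨.ex φ, fun a v x hx hP => exists_congr fun B => ?_⟩
  simpa using hφ a (Fin.cons B v) x (by simpa using hx) (by simpa using hP)

theorem Definable.exPoint {R : ∀ a, C a → (ι → Set (C a)) → (κ → C a) → Prop}
    (h : Definable C fun a v (x : Option κ → C a) => R a (x none) v (fun k => x (some k))) :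
    Definable C fun a v x => ∃ y, R a y v x := by
  obtain ⟨ρ, hρ, P, h⟩ := h
  refine ⟨ρ, hρ, P, fun n f g r => ?_⟩
  obtain ⟨φ, hφ⟩ := h (n + 1) (fun i => (f i).succ) (fun o => o.elim 0 fun k => (g k).succ)
    fun s => (r s).succ
  refine ⟨.ex (.and (.sing 0) φ), fun a v x hx hP => ?_⟩
  have key : ∀ y, φ.Holds (Fin.cons {y} v : Fin (n + 1) → Set (C a)) ↔
      R a y (fun i => v (f i)) x := fun y => by
    simpa using hφ a (Fin.cons {y} v) (fun o => o.elim y x)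
      (by rintro (_ | k) <;> simp [hx]) (by simpa using hP)
  simp only [Formula.Holds, Fin.cons_zero]
  constructor
  · rintro ⟨_, ⟨y, rfl⟩, h⟩
    exact ⟨y, (key y).1 h⟩
  · rintro ⟨y, h⟩
    exact ⟨{y}, ⟨y, rfl⟩, (key y).2 h⟩

theorem Definable.allPoint {R : ∀ a, C a → (ι → Set (C a)) → (κ → C a) → Prop}
    (h : Definable C fun a v (x : Option κ → C a) => R a (x none) v (fun k => x (some k))) :
    Definable C fun a v x => ∀ y, R a y v x :=
  (Definable.exPoint (R := fun a B v x => ¬ R a B v x) h.not).not.congr fun _ _ _ => by simp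

theorem Definable.const {R : ∀ a, Set (C a) → (ι → Set (C a)) → (κ → C a) → Prop}
    (B : ∀ a, Set (C a))
    (h : Definable C fun a (v : Option ι → Set (C a)) x =>
      R a (v none) (fun i => v (some i)) x) :
    Definable C fun a v x => R a (B a) v x := by
  obtain ⟨ρ, hρ, P, h⟩ := h
  refine ⟨Option ρ, inferInstance, fun a o => o.elim (B a) (P a), fun n f g r => ?_⟩
  obtain ⟨φ, hφ⟩ := h n (fun o => o.elim (r none) f) g fun s => r (some s)
  refine ⟨φ, fun a v x hx hP => ?_⟩
  have := hφ a v x hx fun s => hP (some s)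
  simpa [hP none] using this

theorem Definable.rename {ι' κ' : Type} (s : ι → ι') (t : κ → κ')
    {R : ∀ a, (ι → Set (C a)) → (κ → C a) → Prop} (h : Definable C R) :
    Definable C fun a v x => R a (fun i => v (s i)) (fun k => x (t k)) := by
  obtain ⟨ρ, hρ, P, h⟩ := h
  refine ⟨ρ, hρ, P, fun n f g r => ?_⟩
  obtain ⟨φ, hφ⟩ := h n (fun i => f (s i)) (fun k => g (t k)) r
  exact ⟨φ, fun a v x hx hP => hφ a v _ (fun k => hx (t k)) hP⟩

theorem Definable.reindex {A' : Type*} (s : A' → A)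
    {R : ∀ a, (ι → Set (C a)) → (κ → C a) → Prop} (h : Definable C R) :
    Definable (fun a => C (s a)) fun a v x => R (s a) v x := by
  obtain ⟨ρ, hρ, P, h⟩ := h
  refine ⟨ρ, hρ, fun a => P (s a), fun n f g r => ?_⟩
  obtain ⟨φ, hφ⟩ := h n f g r
  exact ⟨φ, fun a => hφ (s a)⟩

theorem Definable.forall_finite {σ : Type} [Finite σ]
    {R : σ → ∀ a, (ι → Set (C a)) → (κ → C a) → Prop} (h : ∀ s, Definable C (R s)) :
    Definable C fun a v x => ∀ s, R s a v x := by
  revert R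
  refine Finite.induction_empty_option (P := fun σ => ∀ {R : σ → ∀ a, (ι → Set (C a)) →
    (κ → C a) → Prop}, (∀ s, Definable C (R s)) → Definable C fun a v x => ∀ s, R s a v x)
    ?_ ?_ ?_ σ
  · intro σ τ e ih R h
    exact (ih fun s => h (e s)).congr fun a v x => e.forall_congr fun _ => Iff.rfl
  · intro R _
    exact definable_true.congr fun a v x => by simp
  · intro σ _ ih R h
    exact ((h none).and (ih fun s => h (some s))).congr fun a v x => by
      rw [Option.forall]

theorem Definable.exSets {σ : Type} [Finite σ]
    {R : ∀ a, (σ → Set (C a)) → (ι → Set (C a)) → (κ → C a) → Prop}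
    (h : Definable C fun a (v : σ ⊕ ι → Set (C a)) x =>
      R a (fun s => v (.inl s)) (fun i => v (.inr i)) x) :
    Definable C fun a v x => ∃ U, R a U v x := by
  revert ι
  refine Finite.induction_empty_option (P := fun σ => ∀ {ι : Type}
    {R : ∀ a, (σ → Set (C a)) → (ι → Set (C a)) → (κ → C a) → Prop}, (Definable C
      fun a (v : σ ⊕ ι → Set (C a)) x => R a (fun s => v (.inl s)) (fun i => v (.inr i)) x) →
    Definable C fun a v x => ∃ U, R a U v x) ?_ ?_ ?_ σ
  · intro σ τ e ih ι R h
    have := ih (R := fun a U v x => R a (fun t => U (e.symm t)) v x)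
      (h.rename (Sum.map e.symm id) id)
    exact this.congr fun a v x => ⟨fun ⟨U, hU⟩ => ⟨_, hU⟩, fun ⟨U, hU⟩ =>
      ⟨fun s => U (e s), by simpa using hU⟩⟩
  · intro ι R h
    refine (h.rename (Sum.elim PEmpty.elim id) id).congr fun a v x => ?_
    constructor
    · intro h
      exact ⟨_, h⟩
    · rintro ⟨U, hU⟩
      rw [Subsingleton.elim U] at hU
      exact hU
  · intro σ _ ih ι R h
    have := Definable.exSet (R := fun a B v x => ∃ U : σ → Set (C a),
      R a (fun o => o.elim B U) v x) (ih (R := fun a U (v : Option ι → Set (C a)) x =>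
      R a (fun o => o.elim (v none) U) (fun i => v (some i)) x)
      ((h.rename (Sum.elim (fun o => o.elim (.inr none) .inl) fun i => .inr (some i)) id).congr
        fun a v x => ?_))
    · refine this.congr fun a v x => ⟨fun ⟨B, U, hU⟩ => ⟨_, hU⟩, fun ⟨U, hU⟩ =>
        ⟨U none, fun s => U (some s), ?_⟩⟩
      convert hU using 2 with o
      cases o <;> rfl
    · refine iff_of_eq ?_
      congr 1
      funext o
      cases o <;> rfl

end Closure

/-! ### Substitution, parameters and satisfaction -/

section Definability

variable {A : Type*} {C : A → Type*} [∀ a, PartialOrder (C a)] {ι κ : Type}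

theorem Definable.subst {ι' : Type} [Finite ι'] {R : ∀ a, (ι' → Set (C a)) → (κ → C a) → Prop}
    {T : ι' → ∀ a, (ι → Set (C a)) → (κ → C a) → Set (C a)} (h : Definable C R)
    (hT : ∀ j, Definable C fun a v (x : Option κ → C a) =>
      x none ∈ T j a v fun k => x (some k)) :
    Definable C fun a v x => R a (fun j => T j a v x) x := by
  have : Definable C fun a v x => ∃ U : ι' → Set (C a),
      (∀ j, ∀ y, y ∈ U j ↔ y ∈ T j a v x) ∧ R a U x := by
    refine Definable.exSets (R := fun a (U : ι' → Set (C a)) v x =>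
      (∀ j, ∀ y, y ∈ U j ↔ y ∈ T j a v x) ∧ R a U x) ?_
    refine .and (.forall_finite fun j => .allPoint ?_) (h.rename Sum.inl id)
    exact (definable_mem none (Sum.inl j)).iff ((hT j).rename Sum.inr id)
  refine this.congr fun a v x => ⟨?_, fun hR => ⟨_, fun _ _ => Iff.rfl, hR⟩⟩
  rintro ⟨U, hU, hR⟩
  have : U = fun j => T j a v x := funext fun j => Set.ext (hU j)
  exact this ▸ hR

theorem Definable.consts {σ : Type} [Finite σ]
    {R : ∀ a, (σ → Set (C a)) → (ι → Set (C a)) → (κ → C a) → Prop}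
    (B : ∀ a, σ → Set (C a))
    (h : Definable C fun a (v : σ ⊕ ι → Set (C a)) x =>
      R a (fun s => v (.inl s)) (fun i => v (.inr i)) x) :
    Definable C fun a v x => R a (B a) v x := by
  obtain ⟨ρ, hρ, P, h⟩ := h
  refine ⟨σ ⊕ ρ, inferInstance, fun a => Sum.elim (B a) (P a), fun n f g r => ?_⟩
  obtain ⟨φ, hφ⟩ := h n (Sum.elim (fun s => r (.inl s)) f) g fun s => r (.inr s)
  refine ⟨φ, fun a v x hx hP => ?_⟩
  have := hφ a v x hx fun s => hP (.inr s)
  simpa [fun s => hP (.inl s)] using this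

theorem definable_mem_const (B : ∀ a, Set (C a)) (k : κ) :
    Definable C fun a (_ : ι → Set (C a)) x => x k ∈ B a :=
  Definable.const (R := fun _ D _ x => x k ∈ D) B (definable_mem k none)

theorem definable_prop (p : Prop) :
    Definable C fun _ (_ : ι → Set _) (_ : κ → _) => p := by
  by_cases hp : p
  · exact definable_true.congr fun _ _ _ => by simp [hp]
  · exact definable_true.not.congr fun _ _ _ => by simp [hp]

/-- A parameter that is everything or empty according to `p a` carries one bit of information about
the index; nonemptiness makes the two cases distinguishable. -/
theorem definable_index [∀ a, Nonempty (C a)] (p : A → Prop) :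
    Definable C fun a (_ : ι → Set (C a)) (_ : κ → C a) => p a := by
  refine (Definable.exPoint (R := fun a y _ _ => y ∈ {_z : C a | p a})
    (definable_mem_const _ none)).congr fun a v x => ?_
  simp

theorem definable_holds {n : ℕ} (φ : Formula n) :
    Definable C fun _ v (_ : κ → _) => φ.Holds v := by
  induction φ with
  | sub i j => exact definable_subset i j
  | sing i => exact definable_sing i
  | lt i j => exact definable_sing_lt i j
  | neg φ ih => exact ih.not
  | and φ ψ ih ih' => exact ih.and ih'
  | ex φ ih =>
    refine Definable.exSet (R := fun a B v _ => φ.Holds (Fin.cons B v)) ?_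
    refine (ih.rename (Fin.cases none some) id).congr fun a v x => ?_
    refine iff_of_eq (congrArg φ.Holds ?_)
    funext k
    cases k using Fin.cases <;> simp

theorem Definable.exists_holds [Finite ι] {R : ∀ a, (ι → Set (C a)) → (Empty → C a) → Prop}
    (h : Definable C R) :
    ∃ (ρ : Type) (_ : Finite ρ) (P : ∀ a, ρ → Set (C a)) (n : ℕ) (e : ι ⊕ ρ ≃ Fin n)
      (φ : Formula n), ∀ a v x, φ.Holds (fun k => Sum.elim v (P a) (e.symm k)) ↔ R a v x := by
  obtain ⟨ρ, hρ, P, h⟩ := h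
  obtain ⟨n, ⟨e⟩⟩ := Finite.exists_equiv_fin (ι ⊕ ρ)
  obtain ⟨φ, hφ⟩ := h n (fun i => e (.inl i)) Empty.elim (fun r => e (.inr r))
  refine ⟨ρ, hρ, P, n, e, φ, fun a v x => ?_⟩
  simpa using hφ a (fun k => Sum.elim v (P a) (e.symm k)) x (fun k => k.elim) (by simp)

/-- A relation definable in one member of a family is the restriction of one definable in the
family. -/
theorem Definable.extend [∀ a, Nonempty (C a)] (b : A)
    {R : ∀ a, (ι → Set (C a)) → (κ → C a) → Prop}
    (h : Definable (fun _ : Unit => C b) fun _ v x => R b v x) :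
    Definable C fun a v x => a = b → R a v x := by
  classical
  obtain ⟨ρ, hρ, P, h⟩ := h
  obtain ⟨ρ', hρ', P', h'⟩ := definable_index (C := C) (ι := ι) (κ := κ) fun a => a = b
  -- Away from `b` the parameters of `φ` are irrelevant, since `φ'` is false there and makes the
  -- implication hold; `∅` is a filler.
  refine ⟨ρ ⊕ ρ', inferInstance, fun a => Sum.elim
    (fun r => if h : a = b then cast (congrArg (fun a => Set (C a)) h.symm) (P () r) else ∅)
    (P' a), fun n f g r => ?_⟩
  obtain ⟨φ, hφ⟩ := h n f g (fun s => r (.inl s))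
  obtain ⟨φ', hφ'⟩ := h' n f g (fun s => r (.inr s))
  refine ⟨.neg (.and φ' (.neg φ)), fun a v x hx hP => ?_⟩
  have h' := hφ' a v x hx fun s => hP (.inr s)
  simp only [Formula.Holds, h', not_and, not_not]
  refine forall_congr' fun hab => ?_
  subst hab
  exact hφ () v x hx fun s => by simpa using hP (.inl s)

end Definability

/-! ### Uniformization of tuples and in families -/

/-- Definability of a family of relations between tuples of sets `X` and `Y`. -/
abbrev DefinableRel {A : Type*} (C : A → Type*) [∀ a, PartialOrder (C a)] {ξ υ : Type}
    (S : ∀ a, (ξ → Set (C a)) → (υ → Set (C a)) → Prop) : Prop :=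
  Definable C fun a (v : ξ ⊕ υ → Set (C a)) (_ : Empty → C a) =>
    S a (fun i => v (Sum.inl i)) (fun j => v (Sum.inr j))

/-- Uniformization, simultaneously in all members of a family of orders, of definable families of
relations between `ξ`-tuples and `υ`-tuples of sets. -/
def Unif {A : Type*} (C : A → Type*) [∀ a, PartialOrder (C a)] (ξ υ : Type) : Prop :=
  ∀ S : ∀ a, (ξ → Set (C a)) → (υ → Set (C a)) → Prop, DefinableRel C S →
    (∀ a Y, ∃ X, S a X Y) →
    ∃ S' : ∀ a, (ξ → Set (C a)) → (υ → Set (C a)) → Prop, DefinableRel C S' ∧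
      (∀ a Y, ∃! X, S' a X Y) ∧ ∀ a X Y, S' a X Y → S a X Y

section Basic

variable {C : Type u} [PartialOrder C]

theorem definableRel_holdsAt {l : ℕ} (φ : Formula (l + 2)) (P : Fin l → Set C) :
    DefinableRel (fun _ : Unit => C) (ξ := Unit) (υ := Unit)
      fun _ X Y => φ.HoldsAt (X ()) (Y ()) P := by
  refine Definable.consts (R := fun _ P (v : Unit ⊕ Unit → Set C) _ => φ.HoldsAt (v (Sum.inl ())) (v (Sum.inr ())) P)
    (fun _ => P) ?_
  refine ((definable_holds φ).rename
    (Fin.cases (Sum.inr (Sum.inl ())) (Fin.cases (Sum.inr (Sum.inr ())) Sum.inl)) id).congr fun a v x => ?_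
  refine iff_of_eq (congrArg φ.Holds ?_)
  funext k
  cases k using Fin.cases with
  | zero => rfl
  | succ k => cases k using Fin.cases <;> rfl

theorem DefinableRel.exists_holdsAt
    {S : Unit → (Unit → Set C) → (Unit → Set C) → Prop}
    (hS : DefinableRel (fun _ : Unit => C) S) :
    ∃ (l : ℕ) (φ : Formula (l + 2)) (P : Fin l → Set C),
      ∀ X Y, φ.HoldsAt X Y P ↔ S () (fun _ => X) fun _ => Y := by
  obtain ⟨ρ, hρ, P, hS⟩ := hS
  obtain ⟨l, ⟨e⟩⟩ := Finite.exists_equiv_fin ρ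
  obtain ⟨φ, hφ⟩ := hS (l + 2) (Sum.elim (fun _ => 0) fun _ => 1) Empty.elim
    fun r => (e r).succ.succ
  refine ⟨l, φ, fun k => P () (e.symm k), fun X Y => ?_⟩
  exact hφ () _ Empty.elim (fun k => k.elim) fun r => by simp

theorem HasUniformizationProperty.unif (h : HasUniformizationProperty C) :
    Unif (fun _ : Unit => C) Unit Unit := by
  intro S hS htot
  obtain ⟨l, φ, P, hφ⟩ := hS.exists_holdsAt
  obtain ⟨k, ψ, Q, h1, h2⟩ := h l φ P fun Y => by
    obtain ⟨X, hX⟩ := htot () fun _ => Y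
    exact ⟨X (), (hφ _ _).2 hX⟩
  refine ⟨_, definableRel_holdsAt ψ Q, ?_, fun _ X Y hψ => (hφ _ _).1 (h2 _ _ hψ)⟩
  intro _ Y
  obtain ⟨X, hX, hu⟩ := h1 (Y ())
  exact ⟨fun _ => X, hX, fun X' hX' => funext fun _ => hu _ hX'⟩

theorem Unif.hasUniformizationProperty (h : Unif (fun _ : Unit => C) Unit Unit) :
    HasUniformizationProperty C := by
  intro l φ P hφ
  obtain ⟨S, hS, h1, h2⟩ := h _ (definableRel_holdsAt φ P) fun _ Y => by
    obtain ⟨X, hX⟩ := hφ (Y ())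
    exact ⟨fun _ => X, hX⟩
  obtain ⟨k, ψ, Q, hψ⟩ := hS.exists_holdsAt
  refine ⟨k, ψ, Q, fun Y => ?_, fun X Y hX => h2 () _ _ ((hψ X Y).1 hX)⟩
  obtain ⟨X, hX, hu⟩ := h1 () fun _ => Y
  exact ⟨X (), (hψ _ _).2 hX, fun X' hX' => congrFun (hu _ ((hψ _ _).1 hX')) ()⟩

/-- There are only finitely many `Y`, so any choice function is defined by a finite list of cases,
with its arguments and values as parameters. -/
theorem unif_of_finite [Finite C] (ξ υ : Type) [Finite ξ] [Finite υ] :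
    Unif (fun _ : Unit => C) ξ υ := by
  intro S _ htot
  choose F hF using htot
  refine ⟨fun a X Y => X = F a Y, ?_, fun a Y => ⟨F a Y, rfl, fun _ h => h⟩,
    fun a X Y h => h ▸ hF a Y⟩
  obtain ⟨m, ⟨e⟩⟩ := Finite.exists_equiv_fin (υ → Set C)
  have : Definable (fun _ : Unit => C) fun a (v : ξ ⊕ υ → Set C) (_ : Empty → C) =>
      ∀ s : Fin m, (∀ j, ∀ y, y ∈ v (Sum.inr j) ↔ y ∈ e.symm s j) →
        ∀ i, ∀ y, y ∈ v (Sum.inl i) ↔ y ∈ F a (e.symm s) i :=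
    .forall_finite fun s => .imp
      (.forall_finite fun j => .allPoint ((definable_mem none _).iff (definable_mem_const _ none)))
      (.forall_finite fun j => .allPoint ((definable_mem none _).iff (definable_mem_const _ none)))
  refine this.congr fun a v _ => ⟨fun h => ?_, fun h s hs => ?_⟩
  · funext i
    ext y
    simpa using h (e fun j => v (Sum.inr j)) (by simp) i y
  · have : (fun j => v (Sum.inr j)) = e.symm s := funext fun j => Set.ext (hs j)
    intro i y
    rw [← this, ← h]

end Basic

section Families

variable {A : Type*} {C : A → Type*} [∀ a, PartialOrder (C a)] {ξ υ : Type}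

theorem DefinableRel.exists_left [Finite ξ]
    {S : ∀ a, (ξ → Set (C a)) → (υ → Set (C a)) → Prop} (hS : DefinableRel C S) {ι κ : Type}
    (s : υ → ι) : Definable C fun a v (_ : κ → C a) => ∃ X, S a X fun j => v (s j) := by
  refine Definable.exSets (R := fun a X v _ => S a X fun j => v (s j)) ?_
  obtain ⟨ρ, hρ, P, h⟩ := hS
  refine ⟨ρ, hρ, P, fun n f g r => ?_⟩
  obtain ⟨φ, hφ⟩ := h n (Sum.elim (fun i => f (Sum.inl i)) fun j => f (Sum.inr (s j))) Empty.elim r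
  exact ⟨φ, fun a v x _ hP => hφ a v Empty.elim (fun k => k.elim) hP⟩

theorem DefinableRel.definable
    {S : ∀ a, (ξ → Set (C a)) → (υ → Set (C a)) → Prop} (hS : DefinableRel C S) {ι κ : Type}
    (r : ξ → ι) (s : υ → ι) :
    Definable C fun a v (_ : κ → C a) => S a (fun i => v (r i)) fun j => v (s j) := by
  obtain ⟨ρ, hρ, P, h⟩ := hS
  refine ⟨ρ, hρ, P, fun n f g t => ?_⟩
  obtain ⟨φ, hφ⟩ := h n (Sum.elim (fun i => f (r i)) fun j => f (s j)) Empty.elim t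
  exact ⟨φ, fun a v x _ hP => hφ a v Empty.elim (fun k => k.elim) hP⟩

/-- Makes the relation total by admitting every `X` over those `Y` that have no solution. -/
theorem Unif.select [Finite ξ] (h : Unif C ξ υ)
    {S : ∀ a, (ξ → Set (C a)) → (υ → Set (C a)) → Prop} (hS : DefinableRel C S) :
    ∃ S' : ∀ a, (ξ → Set (C a)) → (υ → Set (C a)) → Prop, DefinableRel C S' ∧
      (∀ a Y, ∃! X, S' a X Y) ∧ ∀ a X Y, S' a X Y → (∃ X', S a X' Y) → S a X Y := by
  obtain ⟨S', hS', h1, h2⟩ := h (fun a X Y => S a X Y ∨ ¬ ∃ X', S a X' Y)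
    (Definable.or hS (hS.exists_left Sum.inr).not) fun a Y => by
      by_cases hY : ∃ X', S a X' Y
      · exact ⟨_, .inl hY.choose_spec⟩
      · exact ⟨fun _ => ∅, Or.inr hY⟩
  exact ⟨S', hS', h1, fun a X Y hX hY => (h2 a X Y hX).resolve_right (not_not.2 hY)⟩

/-- Uniformizing one coordinate at a time. -/
theorem Unif.tuple (h : ∀ υ : Type, Finite υ → Unif C Unit υ) (ξ υ : Type) [Finite ξ] [Finite υ] :
    Unif C ξ υ := by
  refine Finite.induction_empty_option (P := fun ξ => Finite ξ → Unif C ξ υ) ?_ ?_ ?_ ξ ‹_›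
  · intro ξ ξ' e ih _ S hS htot
    have := Finite.of_equiv _ e.symm
    obtain ⟨S', hS', h1, h2⟩ := ih this (fun a X Y => S a (fun i => X (e.symm i)) Y)
      (hS.definable (fun i => Sum.inl (e.symm i)) Sum.inr) fun a Y => by
        obtain ⟨X, hX⟩ := htot a Y
        exact ⟨fun i => X (e i), by simpa using hX⟩
    refine ⟨fun a X Y => S' a (fun i => X (e i)) Y, hS'.definable (fun i => Sum.inl (e i)) Sum.inr,
      fun a Y => ?_, fun a X Y hX => by simpa using h2 a _ Y hX⟩
    obtain ⟨X, hX, hu⟩ := h1 a Y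
    refine ⟨fun i => X (e.symm i), by simpa using hX, fun X' hX' => ?_⟩
    rw [← hu _ hX']
    simp
  · intro _ S hS htot
    refine ⟨S, hS, fun a Y => ?_, fun _ _ _ hX => hX⟩
    obtain ⟨X, hX⟩ := htot a Y
    exact ⟨X, hX, fun _ _ => Subsingleton.elim _ _⟩
  · intro ξ _ ih _ S hS htot
    have hS' : Definable C fun a (v : Unit ⊕ (ξ ⊕ υ) → Set (C a)) (_ : Empty → C a) =>
        S a (fun o => o.elim (v (Sum.inl ())) fun i => v (Sum.inr (Sum.inl i))) fun j => v (Sum.inr (Sum.inr j)) :=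
      (hS.definable (fun o => o.elim (Sum.inl ()) fun i => Sum.inr (Sum.inl i)) fun j =>
        Sum.inr (Sum.inr j)).congr fun a v _ => by
          refine iff_of_eq (congrArg (S a · _) ?_)
          funext o
          cases o <;> rfl
    -- `T` selects all coordinates but one, for the projection of `S`.
    obtain ⟨T, hT, hT1, hT2⟩ := ih inferInstance
      (fun a X Y => ∃ B : Set (C a), S a (fun o => o.elim B X) Y)
      (Definable.exSet (R := fun a B (v : ξ ⊕ υ → Set (C a)) _ => S a (fun o => o.elim B fun i => v (Sum.inl i))
        fun j => v (Sum.inr j)) ((hS'.rename (Sum.elim (fun _ => none) some) id)))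
      fun a Y => by
        obtain ⟨X, hX⟩ := htot a Y
        refine ⟨fun i => X (some i), X none, ?_⟩
        convert hX using 2 with o
        cases o <;> rfl
    -- The last coordinate is selected with the others as further inputs, which is why the
    -- hypothesis must cover every finite `υ`.
    obtain ⟨T', hT', hT1', hT2'⟩ := (h (ξ ⊕ υ) inferInstance).select
      (S := fun a X Y => S a (fun o => o.elim (X ()) fun i => Y (Sum.inl i)) fun j => Y (Sum.inr j)) hS'
    refine ⟨fun a X Y => T a (fun i => X (some i)) Y ∧
      T' a (fun _ => X none) (Sum.elim (fun i => X (some i)) Y), ?_, fun a Y => ?_, ?_⟩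
    · refine .and (hT.definable (fun i => Sum.inl (some i)) Sum.inr) ?_
      refine (hT'.definable (fun _ => Sum.inl none)
        (Sum.elim (fun i => Sum.inl (some i)) Sum.inr)).congr fun a v _ => ?_
      refine iff_of_eq (congrArg (T' a _) ?_)
      funext o
      cases o <;> rfl
    · obtain ⟨X, hX, hu⟩ := hT1 a Y
      obtain ⟨B, hB, hu'⟩ := hT1' a (Sum.elim X Y)
      refine ⟨fun o => o.elim (B ()) X, ⟨hX, hB⟩, fun X' hX' => ?_⟩
      have e1 := hu _ hX'.1
      have e2 := hu' _ (e1 ▸ hX'.2)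
      funext o
      cases o with
      | none => exact congrFun e2 ()
      | some i => exact congrFun e1 i
    · rintro a X Y ⟨hX, hB⟩
      have := hT2' a _ _ hB (by
        obtain ⟨B, hB⟩ := hT2 a _ _ hX
        exact ⟨fun _ => B, hB⟩)
      refine (iff_of_eq (congrArg (S a · _) ?_)).1 this
      funext o
      cases o <;> rfl

theorem unif_of_forall [Finite A] {A' : Type} (e : A' ≃ A) [∀ a, Nonempty (C a)]
    (h : ∀ a, Unif (fun _ : Unit => C a) ξ υ) : Unif C ξ υ := by
  intro S hS htot
  choose S' hS' h1 h2 using fun a => h a (fun _ => S a) (hS.reindex fun _ => a) fun _ => htot a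
  have : Finite A' := .of_equiv _ e.symm
  refine ⟨fun a => S' a (), ?_, fun a => h1 a (), fun a => h2 a ()⟩
  refine (Definable.forall_finite fun a' => Definable.extend (e a')
    (R := fun a (v : ξ ⊕ υ → Set (C a)) (_ : Empty → C a) =>
      S' a () (fun i => v (Sum.inl i)) fun j => v (Sum.inr j)) (hS' (e a'))).congr fun a v _ => ?_
  exact ⟨fun h => h (e.symm a) (by simp), fun h _ _ => h⟩

/-- The orders agree but the parameters `P a` need not. Treated as further input variables, they
leave a single relation on `D`, whose uniformizer serves all `a`. It need not be total for arbitrary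
values of these inputs, hence the use of `Unif.select`. -/
theorem unif_const {D : Type*} [PartialOrder D] [Finite ξ] [Finite υ]
    (h : ∀ υ : Type, Finite υ → Unif (fun _ : Unit => D) ξ υ) : Unif (fun _ : A => D) ξ υ := by
  intro S hS htot
  obtain ⟨ρ, hρ, P, n, e, φ, hφ⟩ := hS.exists_holds
  obtain ⟨S', hS', h1, h2⟩ := (h (υ ⊕ ρ) inferInstance).select
    (S := fun _ X Y => φ.Holds fun k => Sum.elim (Sum.elim X fun j => Y (Sum.inl j))
      (fun r => Y (Sum.inr r)) (e.symm k))
    (((definable_holds φ).rename (fun k => Sum.elim (Sum.elim Sum.inl fun j => Sum.inr (Sum.inl j))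
      (fun r => Sum.inr (Sum.inr r)) (e.symm k)) id).congr fun a v _ => by
        refine iff_of_eq (congrArg φ.Holds ?_)
        funext k
        rcases e.symm k with (_ | _) | _ <;> rfl)
  have key : ∀ a X Y, φ.Holds (fun k => Sum.elim (Sum.elim X Y) (P a) (e.symm k)) ↔ S a X Y :=
    fun a X Y => hφ a (Sum.elim X Y) Empty.elim
  refine ⟨fun a X Y => S' () X (Sum.elim Y (P a)), ?_, fun a Y => h1 () _, fun a X Y hX => ?_⟩
  · refine Definable.consts (R := fun _ Q (v : ξ ⊕ υ → Set D) _ => S' () (fun i => v (Sum.inl i))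
      (Sum.elim (fun j => v (Sum.inr j)) Q)) P ?_
    refine ((hS'.definable (fun i => Sum.inr (Sum.inl i))
      (Sum.elim (fun j => Sum.inr (Sum.inr j)) Sum.inl)).reindex fun _ => ()).congr fun a v _ => ?_
    refine iff_of_eq (congrArg (S' () _) ?_)
    funext o
    cases o <;> rfl
  · obtain ⟨X', hX'⟩ := htot a Y
    exact (key a X Y).1 (h2 () X _ hX ⟨X', (key a X' Y).2 hX'⟩)

end Families

/-! ### Relativization to coded suborders -/

theorem exists_singleton_lt_iff {α : Type*} [PartialOrder α] (A B : Set α) :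
    (∃ x y, A = {x} ∧ B = {y} ∧ x < y) ↔
      (∃ x, A = {x}) ∧ (∃ y, B = {y}) ∧ ∃ x y, x ∈ A ∧ y ∈ B ∧ x < y := by
  constructor
  · rintro ⟨x, y, rfl, rfl, h⟩
    exact ⟨⟨x, rfl⟩, ⟨y, rfl⟩, x, y, rfl, rfl, h⟩
  · rintro ⟨⟨x, rfl⟩, ⟨y, rfl⟩, _, _, rfl, rfl, h⟩
    exact ⟨_, _, rfl, rfl, h⟩

section Relativization

variable {C : Type*} [PartialOrder C] {T : Type*} {D : T → Type*} [∀ t, PartialOrder (D t)]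
  {ι κ : Type}

theorem Definable.of_codes {c : T → κ → C}
    (hdom : Definable (fun _ : Unit => C) fun _ (_ : Empty → Set C) x => ∃ t, x = c t)
    {q : (ι → Set C) → (κ → C) → Prop} {p : T → (ι → Set C) → Prop}
    (hq : Definable (fun _ : Unit => C) fun _ v x => q v x) (hpq : ∀ t v, q v (c t) ↔ p t v) :
    Definable (fun _ : Unit => C) fun _ v x => ∃ t, x = c t ∧ p t v := by
  refine ((hdom.rename Empty.elim id).and hq).congr fun _ v x => ⟨?_, ?_⟩
  · rintro ⟨⟨t, ht⟩, h⟩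
    obtain rfl : x = c t := ht
    exact ⟨t, rfl, (hpq t v).1 h⟩
  · rintro ⟨t, rfl, h⟩
    exact ⟨⟨t, rfl⟩, (hpq t v).2 h⟩

variable {c : T → κ → C} {g : ∀ t, D t → C} (hc : Function.Injective c)
  (hg : Function.Injective fun p : Σ t, D t => g p.1 p.2)
  (hlt : ∀ t a b, g t a < g t b ↔ a < b)
  (hdom : Definable (fun _ : Unit => C) fun _ (_ : Empty → Set C) x => ∃ t, x = c t)
  (hmem : Definable (fun _ : Unit => C) fun _ (_ : Empty → Set C) (x : Option κ → C) =>
    ∃ t a, (fun k => x (some k)) = c t ∧ x none = g t a)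

include hc hg hlt hdom hmem

/-- Relativization by induction on `φ`: points are restricted to the suborder with code `x`, and a
set quantifier over `D t` may range over all of `C`, because every subset of `D t` is the preimage
of its image. -/
theorem definable_holds_preimage {n : ℕ} (φ : Formula n) :
    Definable (fun _ : Unit => C) fun _ v x =>
      ∃ t, x = c t ∧ φ.Holds fun k => g t ⁻¹' v k := by
  have hg' : ∀ t a b, g t a = g t b ↔ a = b := fun t a b =>
    ⟨fun h => by simpa using @hg ⟨t, a⟩ ⟨t, b⟩ h, fun h => h ▸ rfl⟩
  have hmem' : ∀ t y, (∃ t' a, c t = c t' ∧ y = g t' a) ↔ ∃ a, y = g t a := fun t y =>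
    ⟨fun ⟨t', a, h, hy⟩ => by obtain rfl := hc h; exact ⟨a, hy⟩, fun ⟨a, h⟩ => ⟨t, a, rfl, h⟩⟩
  have hcode : ∀ t (p : T → Prop), (∃ t', c t = c t' ∧ p t') ↔ p t := fun t p =>
    ⟨fun ⟨t', h, hp⟩ => by obtain rfl := hc h; exact hp, fun h => ⟨t, rfl, h⟩⟩
  have hsing : ∀ {n : ℕ} (i : Fin n), Definable (fun _ : Unit => C) fun _ v x =>
      ∃ t, x = c t ∧ ∃ a, g t ⁻¹' v i = {a} := fun {n} i => by
    refine .of_codes (q := fun v x => ∃ y, (∃ t a, x = c t ∧ y = g t a) ∧ y ∈ v i ∧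
      ∀ z, (∃ t a, x = c t ∧ z = g t a) → z ∈ v i → z = y) hdom ?_ fun t v => ?_
    · refine Definable.exPoint (R := fun _ y v x => (∃ t a, x = c t ∧ y = g t a) ∧ y ∈ v i ∧
        ∀ z, (∃ t a, x = c t ∧ z = g t a) → z ∈ v i → z = y) ?_
      refine .and (hmem.rename Empty.elim id) (.and (definable_mem none i) ?_)
      refine Definable.allPoint (R := fun _ z v (x : Option κ → C) =>
        (∃ t a, (fun k => x (some k)) = c t ∧ z = g t a) → z ∈ v i → z = x none) ?_
      exact .imp (hmem.rename Empty.elim (fun o => o.elim none fun k => some (some k)))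
        (.imp (definable_mem none i) (definable_eq none (some none)))
    · simp only [hmem', Set.eq_singleton_iff_unique_mem]
      constructor
      · rintro ⟨_, ⟨a, rfl⟩, h, hu⟩
        exact ⟨a, h, fun b hb => (hg' _ _ _).1 (hu _ ⟨b, rfl⟩ hb)⟩
      · rintro ⟨a, h, hu⟩
        refine ⟨_, ⟨a, rfl⟩, h, ?_⟩
        rintro _ ⟨b, rfl⟩ hb
        rw [hu b hb]
  induction φ with
  | sub i j =>
    refine .of_codes (q := fun v x => ∀ y, (∃ t a, x = c t ∧ y = g t a) → y ∈ v i → y ∈ v j)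
      hdom ?_ fun t v => ?_
    · refine Definable.allPoint (R := fun _ y v x => (∃ t a, x = c t ∧ y = g t a) →
        y ∈ v i → y ∈ v j) ?_
      exact .imp (hmem.rename Empty.elim id) (.imp (definable_mem none i) (definable_mem none j))
    · simp only [hmem', Formula.Holds]
      exact ⟨fun h a => h _ ⟨a, rfl⟩, fun h y ⟨a, ha⟩ => ha ▸ @h a⟩
  | sing i => exact hsing i
  | lt i j =>
    refine .of_codes (q := fun v x => (∃ t, x = c t ∧ ∃ a, g t ⁻¹' v i = {a}) ∧
      (∃ t, x = c t ∧ ∃ a, g t ⁻¹' v j = {a}) ∧ ∃ y, ∃ z, (∃ t a, x = c t ∧ y = g t a) ∧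
      (∃ t a, x = c t ∧ z = g t a) ∧ y ∈ v i ∧ z ∈ v j ∧ y < z) hdom ?_ fun t v => ?_
    · refine .and (hsing i) (.and (hsing j) ?_)
      refine Definable.exPoint (R := fun _ y v x => ∃ z, (∃ t a, x = c t ∧ y = g t a) ∧
        (∃ t a, x = c t ∧ z = g t a) ∧ y ∈ v i ∧ z ∈ v j ∧ y < z) ?_
      refine Definable.exPoint (R := fun _ z v (x : Option κ → C) =>
        (∃ t a, (fun k => x (some k)) = c t ∧ x none = g t a) ∧
        (∃ t a, (fun k => x (some k)) = c t ∧ z = g t a) ∧ x none ∈ v i ∧ z ∈ v j ∧ x none < z) ?_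
      exact .and (hmem.rename Empty.elim some) (.and
        (hmem.rename Empty.elim (fun o => o.elim none fun k => some (some k)))
        (.and (definable_mem _ i) (.and (definable_mem none j) (definable_lt _ _))))
    · simp only [hcode, hmem', Formula.Holds]
      rw [exists_singleton_lt_iff]
      refine and_congr_right fun _ => and_congr_right fun _ => ⟨?_, ?_⟩
      · rintro ⟨_, _, ⟨a, rfl⟩, ⟨b, rfl⟩, ha, hb, h⟩
        exact ⟨a, b, ha, hb, (hlt _ _ _).1 h⟩
      · rintro ⟨a, b, ha, hb, h⟩
        exact ⟨_, _, ⟨a, rfl⟩, ⟨b, rfl⟩, ha, hb, (hlt _ _ _).2 h⟩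
  | neg φ ih =>
    exact .of_codes hdom ih.not fun t v => not_congr (hcode t _)
  | and φ ψ ih ih' =>
    exact .of_codes (q := fun v x => (∃ t, x = c t ∧ φ.Holds fun k => g t ⁻¹' v k) ∧
      ∃ t, x = c t ∧ ψ.Holds fun k => g t ⁻¹' v k) hdom (ih.and ih') fun t v => 
      and_congr (hcode t fun t => φ.Holds fun k => g t ⁻¹' v k)
        (hcode t fun t => ψ.Holds fun k => g t ⁻¹' v k)
  | ex φ ih =>
    refine .of_codes (q := fun v x => ∃ B : Set C, ∃ t, x = c t ∧
      φ.Holds fun k => g t ⁻¹' (Fin.cons B v : Fin _ → Set C) k) hdom ?_ fun t v => ?_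
    · refine Definable.exSet (R := fun _ B v x => ∃ t, x = c t ∧
        φ.Holds fun k => g t ⁻¹' (Fin.cons B v : Fin _ → Set C) k) ?_
      refine (ih.rename (Fin.cases none some) id).congr fun _ v x => ?_
      refine exists_congr fun t => and_congr Iff.rfl (iff_of_eq (congrArg φ.Holds ?_))
      funext k
      cases k using Fin.cases <;> rfl
    · simp only [hcode, Formula.Holds]
      have hcons : ∀ B : Set C, (fun k => g t ⁻¹' (Fin.cons B v : Fin _ → Set C) k) =
          (Fin.cons (g t ⁻¹' B) fun k => g t ⁻¹' v k) := fun B => by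
        funext k
        cases k using Fin.cases <;> rfl
      simp only [hcons]
      constructor
      · rintro ⟨B, h⟩
        exact ⟨_, h⟩
      · rintro ⟨B, h⟩
        refine ⟨g t '' B, ?_⟩
        rwa [Set.preimage_image_eq B fun a b => (hg' t a b).1]

/-- Relations definable in a family of suborders of `C` coded by points of `C` are definable
in `C`. -/
theorem Definable.preimage [Finite ι] {θ : ∀ t, (ι → Set (D t)) → Prop}
    (h : Definable D fun t v (_ : Empty → D t) => θ t v) :
    Definable (fun _ : Unit => C) fun _ v x => ∃ t, x = c t ∧ θ t fun i => g t ⁻¹' v i := by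
  obtain ⟨ρ, hρ, P, n, e, φ, hφ⟩ := h.exists_holds
  have := definable_holds_preimage hc hg hlt hdom hmem φ
  -- The suborders are pairwise disjoint by `hg`, so their parameters can be merged into subsets of
  -- `C` and recovered by preimage.
  refine (Definable.consts (R := fun _ Q v x => ∃ t, x = c t ∧ φ.Holds fun k =>
    g t ⁻¹' (Sum.elim v Q (e.symm k))) (fun _ r => {x | ∃ t, ∃ a ∈ P t r, g t a = x}) ?_).congr
    fun _ v x => exists_congr fun t => and_congr Iff.rfl ?_
  · refine (this.rename (fun k => Sum.swap (e.symm k)) id).congr fun _ v x => ?_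
    refine exists_congr fun t => and_congr Iff.rfl (iff_of_eq (congrArg φ.Holds ?_))
    funext k
    change g t ⁻¹' v (Sum.swap (e.symm k)) = _
    rcases e.symm k with _ | _ <;> rfl
  · rw [← hφ t _ Empty.elim]
    refine iff_of_eq (congrArg φ.Holds ?_)
    funext k
    rcases e.symm k with i | r
    · rfl
    · ext a
      constructor
      · rintro ⟨t', b, hb, h⟩
        cases @hg ⟨t', b⟩ ⟨t, a⟩ h
        exact hb
      · intro ha
        exact ⟨t, a, ha, rfl⟩

end Relativization

/-! ### The composition theorem for sums -/

section Decomposable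

variable {I : Type*} [PartialOrder I] {M : I → Type*} [∀ i, PartialOrder (M i)]
  {C : Type*} {e : ∀ i, M i → C} {ι : Type}

/-- `R` reduces to a definable relation in the index order between the sets of indices at which
finitely many definable relations hold in the summands. -/
def Decomposable (e : ∀ i, M i → C) (R : (ι → Set C) → Prop) : Prop :=
  ∃ (σ : Type) (_ : Finite σ) (θ : σ → ∀ i, (ι → Set (M i)) → Prop) (Φ : (σ → Set I) → Prop),
    (∀ s, Definable M fun i v (_ : Empty → M i) => θ s i v) ∧
    (Definable (fun _ : Unit => I) fun _ U (_ : Empty → I) => Φ U) ∧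
    ∀ v, R v ↔ Φ fun s => {i | θ s i fun k => e i ⁻¹' v k}

namespace Decomposable

theorem congr {R S : (ι → Set C) → Prop} (h : Decomposable e R) (hRS : ∀ v, R v ↔ S v) :
    Decomposable e S := by
  obtain ⟨σ, hσ, θ, Φ, hθ, hΦ, h⟩ := h
  exact ⟨σ, hσ, θ, Φ, hθ, hΦ, fun v => (hRS v).symm.trans (h v)⟩

theorem not {R : (ι → Set C) → Prop} (h : Decomposable e R) : Decomposable e fun v => ¬ R v := by
  obtain ⟨σ, hσ, θ, Φ, hθ, hΦ, h⟩ := h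
  exact ⟨σ, hσ, θ, fun U => ¬ Φ U, hθ, hΦ.not, fun v => not_congr (h v)⟩

theorem and {R S : (ι → Set C) → Prop} (h : Decomposable e R) (h' : Decomposable e S) :
    Decomposable e fun v => R v ∧ S v := by
  obtain ⟨σ, hσ, θ, Φ, hθ, hΦ, h⟩ := h
  obtain ⟨σ', hσ', θ', Φ', hθ', hΦ', h'⟩ := h'
  refine ⟨σ ⊕ σ', inferInstance, Sum.elim θ θ',
    fun U => Φ (fun s => U (.inl s)) ∧ Φ' fun s => U (.inr s), ?_,
    (hΦ.rename Sum.inl id).and (hΦ'.rename Sum.inr id), fun v => and_congr (h v) (h' v)⟩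
  rintro (s | s)
  · exact hθ s
  · exact hθ' s

theorem rename {ι' : Type} (s : ι → ι') {R : (ι → Set C) → Prop} (h : Decomposable e R) :
    Decomposable e fun v => R fun i => v (s i) := by
  obtain ⟨σ, hσ, θ, Φ, hθ, hΦ, h⟩ := h
  exact ⟨σ, hσ, fun t i v => θ t i fun k => v (s k), Φ, fun t => (hθ t).rename s id, hΦ,
    fun v => h _⟩

end Decomposable

end Decomposable

/-- `C` is the sum of the orders `M i` over the order `I`, with `e i` the embedding of `M i`. -/
structure IsLexSum {I : Type*} [PartialOrder I] {M : I → Type*} [∀ i, PartialOrder (M i)]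
    {C : Type*} [PartialOrder C] (e : ∀ i, M i → C) : Prop where
  bijective : Function.Bijective fun p : Σ i, M i => e p.1 p.2
  lt_fiber : ∀ i a b, e i a < e i b ↔ a < b
  lt_base : ∀ i j a b, i ≠ j → (e i a < e j b ↔ i < j)

section Composition

variable {I : Type*} [PartialOrder I] {M : I → Type*} [∀ i, PartialOrder (M i)]
  {C : Type*} [PartialOrder C] {e : ∀ i, M i → C} {ι : Type}

namespace IsLexSum

variable (he : IsLexSum e)

include he

theorem eq_iff {i j : I} {a : M i} {b : M j} :
    e i a = e j b ↔ (⟨i, a⟩ : Σ i, M i) = ⟨j, b⟩ :=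
  ⟨fun h => he.bijective.1 h, fun h => by cases h; rfl⟩

theorem eq_fiber_iff {i : I} {a b : M i} : e i a = e i b ↔ a = b := by
  rw [he.eq_iff]
  simp

theorem exists_eq (x : C) : ∃ i a, e i a = x := by
  obtain ⟨⟨i, a⟩, h⟩ := he.bijective.2 x
  exact ⟨i, a, h⟩

theorem preimage_glue (B : ∀ i, Set (M i)) (i : I) :
    e i ⁻¹' {x | ∃ j, ∃ a ∈ B j, e j a = x} = B i := by
  ext a
  constructor
  · rintro ⟨j, b, hb, h⟩
    cases he.eq_iff.1 h
    exact hb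
  · intro ha
    exact ⟨i, a, ha, rfl⟩

theorem ext_preimage {B B' : Set C} (h : ∀ i, e i ⁻¹' B = e i ⁻¹' B') : B = B' := by
  ext x
  obtain ⟨i, a, rfl⟩ := he.exists_eq x
  exact Set.ext_iff.1 (h i) a

theorem exists_eq_singleton_iff (B : Set C) :
    (∃ x, B = {x}) ↔ ∃ i, (∃ a, e i ⁻¹' B = {a}) ∧ ∀ j, j = i ∨ ∀ a, a ∉ e j ⁻¹' B := by
  constructor
  · rintro ⟨x, rfl⟩
    obtain ⟨i, a, rfl⟩ := he.exists_eq x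
    refine ⟨i, ⟨a, ?_⟩, fun j => or_iff_not_imp_left.2 fun hj b hb => ?_⟩
    · ext b
      exact he.eq_fiber_iff
    · cases he.eq_iff.1 (show e j b = e i a from hb)
      exact hj rfl
  · rintro ⟨i, ⟨a, ha⟩, hj⟩
    refine ⟨e i a, ?_⟩
    ext x
    obtain ⟨j, b, rfl⟩ := he.exists_eq x
    rcases hj j with rfl | hj
    · rw [Set.mem_singleton_iff, he.eq_fiber_iff]
      exact Set.ext_iff.1 ha b
    · refine iff_of_false (hj b) fun h => hj b ?_
      cases he.eq_iff.1 (show e j b = e i a from h)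
      rw [ha]
      rfl

theorem exists_lt_iff (B B' : Set C) :
    (∃ x y, x ∈ B ∧ y ∈ B' ∧ x < y) ↔
      (∃ i, ∃ a b, a ∈ e i ⁻¹' B ∧ b ∈ e i ⁻¹' B' ∧ a < b) ∨
        ∃ i j, (∃ a, a ∈ e i ⁻¹' B) ∧ (∃ b, b ∈ e j ⁻¹' B') ∧ i < j := by
  constructor
  · rintro ⟨x, y, hx, hy, h⟩
    obtain ⟨i, a, rfl⟩ := he.exists_eq x
    obtain ⟨j, b, rfl⟩ := he.exists_eq y
    by_cases hij : i = j
    · subst hij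
      exact .inl ⟨i, a, b, hx, hy, (he.lt_fiber _ _ _).1 h⟩
    · exact .inr ⟨i, j, ⟨a, hx⟩, ⟨b, hy⟩, (he.lt_base _ _ _ _ hij).1 h⟩
  · rintro (⟨i, a, b, ha, hb, h⟩ | ⟨i, j, ⟨a, ha⟩, ⟨b, hb⟩, h⟩)
    · exact ⟨_, _, ha, hb, (he.lt_fiber _ _ _).2 h⟩
    · exact ⟨_, _, ha, hb, (he.lt_base _ _ _ _ h.ne).2 h⟩

end IsLexSum

namespace Decomposable

/-- A set `B` is a free choice of one piece in each summand. A tuple `U` of index sets prescribes at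
`i` the pattern `{s | i ∈ U s}`, and it comes from some `B` exactly when each summand has a piece
with its prescribed pattern. Hence the new local formulas, indexed by `Set σ`, express that a
pattern is realizable, and the quantifier over `B` becomes one over `U` in the index order. -/
theorem ex (he : IsLexSum e) {R : (Option ι → Set C) → Prop} (h : Decomposable e R) :
    Decomposable e fun v => ∃ B, R fun o => o.elim B v := by
  obtain ⟨σ, hσ, θ, Φ, hθ, hΦ, h⟩ := h
  refine ⟨Set σ, inferInstance,
    fun E i v => ∃ B, ∀ s, θ s i (fun o => o.elim B v) ↔ s ∈ E,
    fun W => ∃ U : σ → Set I, Φ U ∧ ∀ E : Set σ, ∀ i, (∀ s, i ∈ U s ↔ s ∈ E) → i ∈ W E,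
    fun E => ?_, ?_, fun v => ?_⟩
  · refine Definable.exSet
      (R := fun i B v _ => ∀ s, θ s i (fun o => o.elim B v) ↔ s ∈ E) ?_
    refine .forall_finite fun s => .iff ((hθ s).congr fun i v _ => ?_) (definable_prop _)
    refine iff_of_eq (congrArg (θ s i) ?_)
    funext o
    cases o <;> rfl
  · refine Definable.exSets (R := fun _ U W _ => Φ U ∧
      ∀ E : Set σ, ∀ i, (∀ s, i ∈ U s ↔ s ∈ E) → i ∈ W E) ?_
    refine .and (hΦ.rename Sum.inl id) (.forall_finite fun E => .allPoint ?_)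
    exact .imp (.forall_finite fun s => .iff (definable_mem none (Sum.inl s)) (definable_prop _))
      (definable_mem none (Sum.inr E))
  · have hpre : ∀ B i, (fun o : Option ι => e i ⁻¹' o.elim B v) =
        fun o => o.elim (e i ⁻¹' B) fun k => e i ⁻¹' v k := fun B i => by
      funext o
      cases o <;> rfl
    constructor
    · rintro ⟨B, hB⟩
      refine ⟨_, (h _).1 hB, fun E i hE => ⟨e i ⁻¹' B, fun s => ?_⟩⟩
      rw [← hE, ← hpre]
      rfl
    · rintro ⟨U, hU, hW⟩
      choose B hB using fun i => hW {s | i ∈ U s} i fun s => Iff.rfl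
      refine ⟨{x | ∃ j, ∃ a ∈ B j, e j a = x}, (h _).2 ?_⟩
      convert hU using 1
      funext s
      ext i
      rw [Set.mem_ofPred_eq, hpre, he.preimage_glue]
      exact hB i s

theorem sing (he : IsLexSum e) (k : ι) : Decomposable e fun v => ∃ x, v k = {x} := by
  refine ⟨Bool, inferInstance,
    fun s i v => cond s (∃ a, v k = {a}) (∀ a, a ∉ v k),
    fun U => ∃ i, i ∈ U true ∧ ∀ j, j = i ∨ j ∈ U false, ?_, ?_,
    fun v => he.exists_eq_singleton_iff _⟩
  · rintro (_ | _)
    · exact .allPoint (definable_mem none k).not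
    · exact definable_sing k
  · refine Definable.exPoint (R := fun _ i U _ => i ∈ U true ∧ ∀ j, j = i ∨ j ∈ U false) ?_
    refine .and (definable_mem _ _) ?_
    refine Definable.allPoint (R := fun _ j (U : Bool → Set I) (x : Option Empty → I) =>
      j = x none ∨ j ∈ U false) ?_
    exact .or (definable_eq none (some none)) (definable_mem none false)

theorem exists_lt (he : IsLexSum e) (k l : ι) :
    Decomposable e fun v => ∃ x y, x ∈ v k ∧ y ∈ v l ∧ x < y := by
  refine ⟨Option Bool, inferInstance,
    fun s i v => s.elim (∃ a b, a ∈ v k ∧ b ∈ v l ∧ a < b)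
      fun s => cond s (∃ a, a ∈ v k) (∃ b, b ∈ v l),
    fun U => (∃ i, i ∈ U none) ∨ ∃ i j, i ∈ U (some true) ∧ j ∈ U (some false) ∧ i < j, ?_, ?_,
    fun v => he.exists_lt_iff _ _⟩
  · rintro (_ | _ | _)
    · refine Definable.exPoint (R := fun _ a v _ => ∃ b, a ∈ v k ∧ b ∈ v l ∧ a < b) ?_
      refine Definable.exPoint (R := fun i b v (x : Option Empty → M i) =>
        x none ∈ v k ∧ b ∈ v l ∧ x none < b) ?_
      exact .and (definable_mem _ k) (.and (definable_mem none l) (definable_lt _ _))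
    · exact .exPoint (definable_mem none l)
    · exact .exPoint (definable_mem none k)
  · refine .or (.exPoint (definable_mem none none)) ?_
    refine Definable.exPoint (R := fun _ i U _ =>
      ∃ j, i ∈ U (some true) ∧ j ∈ U (some false) ∧ i < j) ?_
    refine Definable.exPoint (R := fun _ j U (x : Option Empty → I) =>
      x none ∈ U (some true) ∧ j ∈ U (some false) ∧ x none < j) ?_
    exact .and (definable_mem _ _) (.and (definable_mem none _) (definable_lt _ _))

theorem holds (he : IsLexSum e) {n : ℕ} (φ : Formula n) : Decomposable e φ.Holds := by
  induction φ with
  | sub k l =>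
    refine ⟨Unit, inferInstance, fun _ i v => v k ⊆ v l, fun U => ∀ i, i ∈ U (),
      fun _ => definable_subset k l, .allPoint (definable_mem none ()), fun v => ⟨?_, ?_⟩⟩
    · exact fun h i a ha => h ha
    · intro h x hx
      obtain ⟨i, a, rfl⟩ := he.exists_eq x
      exact h i hx
  | sing k => exact sing he k
  | lt k l =>
    exact ((sing he k).and ((sing he l).and (exists_lt he k l))).congr fun v =>
      (exists_singleton_lt_iff _ _).symm
  | neg φ ih => exact ih.not
  | and φ ψ ih ih' => exact ih.and ih'
  | ex φ ih =>
    refine ((ih.rename (Fin.cases none some)).ex he).congr fun v => exists_congr fun B => ?_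
    refine iff_of_eq (congrArg φ.Holds ?_)
    funext k
    cases k using Fin.cases <;> rfl

end Decomposable

theorem Definable.decomposable [Finite ι] (he : IsLexSum e) {R : (ι → Set C) → Prop}
    (h : Definable (fun _ : Unit => C) fun _ v (_ : Empty → C) => R v) : Decomposable e R := by
  obtain ⟨ρ, hρ, P, n, f, φ, hφ⟩ := h.exists_holds
  obtain ⟨σ, hσ, θ, Φ, hθ, hΦ, h⟩ := (Decomposable.holds he φ).rename (f.symm ·)
  -- Each parameter of `C` is cut into its traces on the summands, which become parameters there.
  refine ⟨σ, hσ, fun s i v => θ s i (Sum.elim v fun r => e i ⁻¹' P () r), Φ, fun s => ?_, hΦ,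
    fun v => ?_⟩
  · refine Definable.consts (R := fun i Q v _ => θ s i (Sum.elim v Q))
      (fun i r => e i ⁻¹' P () r) ?_
    refine ((hθ s).rename Sum.swap id).congr fun i v _ => ?_
    refine iff_of_eq (congrArg (θ s i) ?_)
    funext o
    cases o <;> rfl
  · refine (hφ () v Empty.elim).symm.trans ((h _).trans ?_)
    refine iff_of_eq (congrArg Φ ?_)
    funext s
    ext i
    refine iff_of_eq (congrArg (θ s i) ?_)
    funext o
    cases o <;> rfl

end Composition

/-! ### Uniformization in sums -/

section LexSum

variable {I : Type*} [PartialOrder I] {M : I → Type*} [∀ i, PartialOrder (M i)]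
  {C : Type*} [PartialOrder C] {e : ∀ i, M i → C} {ι κ : Type}

theorem definable_const_mem {A : Type*} {C : A → Type*} [∀ a, PartialOrder (C a)]
    (b : ∀ a, C a) (i : ι) : Definable C fun a v (_ : κ → C a) => b a ∈ v i := by
  refine (Definable.exPoint (R := fun a y v _ => y ∈ ({b a} : Set (C a)) ∧ y ∈ v i)
    (.and (definable_mem_const _ none) (definable_mem none i))).congr fun a v x => ?_
  simp

theorem definable_le {A : Type*} {C : A → Type*} [∀ a, PartialOrder (C a)] (k l : κ) :
    Definable C fun _ (_ : ι → Set _) x => x k ≤ x l :=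
  ((definable_lt k l).or (definable_eq k l)).congr fun _ _ _ => le_iff_lt_or_eq.symm

theorem IsLexSum.le_fiber (he : IsLexSum e) {i : I} {a b : M i} : e i a ≤ e i b ↔ a ≤ b := by
  rw [le_iff_lt_or_eq, he.lt_fiber, he.eq_fiber_iff, le_iff_lt_or_eq]

theorem IsLexSum.le_base (he : IsLexSum e) {i j : I} {a : M i} {b : M j} (hij : i ≠ j) :
    e i a ≤ e j b ↔ i < j := by
  rw [le_iff_lt_or_eq, he.lt_base _ _ _ _ hij, he.eq_iff]
  exact or_iff_left fun h => hij (congrArg Sigma.fst h)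

theorem IsLexSum.definable_fiber (he : IsLexSum e) {m : ∀ i, M i} (hm : ∀ i a, m i ≤ a)
    [Finite ι] {θ : ∀ i, (ι → Set (M i)) → Prop}
    (h : Definable M fun i v (_ : Empty → M i) => θ i v) :
    Definable (fun _ : Unit => C) fun _ v (x : Unit → C) =>
      ∃ i, (x = fun _ => e i (m i)) ∧ θ i fun k => e i ⁻¹' v k := by
  refine Definable.preimage (c := fun i _ => e i (m i)) ?_ he.bijective.1 he.lt_fiber ?_ ?_ h
  · intro i j hij
    exact congrArg Sigma.fst (he.eq_iff.1 (congrFun hij ()))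
  · refine (definable_mem_const (fun _ => Set.range fun i => e i (m i)) ()).congr fun _ v x => ?_
    constructor
    · rintro ⟨i, h⟩
      exact ⟨i, funext fun _ => h.symm⟩
    · rintro ⟨i, h⟩
      exact ⟨i, (congrFun h ()).symm⟩
  -- With the set of least elements as a parameter, the summand of a point is identified by the
  -- largest least element below or equal to it.
  · refine ((definable_mem_const (fun _ => Set.range fun i => e i (m i)) (some ())).and
      ((definable_le (some ()) none).and (Definable.allPoint (R := fun _ y _ (x : Option Unit → C) =>
        y ∈ Set.range (fun i => e i (m i)) → y ≤ x none → y ≤ x (some ()))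
        (.imp (definable_mem_const _ none) (.imp (definable_le none (some none))
          (definable_le none (some (some ())))))))).congr fun _ v x => ?_
    constructor
    · rintro ⟨⟨i, hi⟩, hle, hmax⟩
      obtain ⟨j, b, hj⟩ := he.exists_eq (x none)
      refine ⟨i, ?_⟩
      by_cases hij : i = j
      · subst hij
        exact ⟨b, funext fun _ => hi.symm, hj.symm⟩
      · rw [← hi, ← hj] at hle
        have := hmax _ ⟨j, rfl⟩ (by rw [← hj]; exact he.le_fiber.2 (hm j b))
        rw [← hi] at this
        exact absurd ((he.le_base hij).1 hle) ((he.le_base (Ne.symm hij)).1 this).not_gt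
    · rintro ⟨i, a, hi, ha⟩
      have hi : x (some ()) = e i (m i) := congrFun hi ()
      rw [hi, ha]
      refine ⟨⟨i, rfl⟩, he.le_fiber.2 (hm i a), ?_⟩
      rintro _ ⟨j, rfl⟩ hj
      by_cases hij : j = i
      · subst hij
        exact le_rfl
      · exact (he.le_base hij).2 ((he.le_base hij).1 hj)

/-- The least elements form a copy of `I` inside `C`. There `Φ` is relativized to that copy, and
`definable_fiber` defines the sets of least elements whose summands satisfy `θ s`. -/
theorem IsLexSum.definable_comp (he : IsLexSum e) {m : ∀ i, M i} (hm : ∀ i a, m i ≤ a)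
    [Finite ι] {σ : Type} [Finite σ] {θ : σ → ∀ i, (ι → Set (M i)) → Prop}
    {Φ : (σ → Set I) → Prop} (hθ : ∀ s, Definable M fun i v (_ : Empty → M i) => θ s i v)
    (hΦ : Definable (fun _ : Unit => I) fun _ U (_ : Empty → I) => Φ U) :
    Definable (fun _ : Unit => C) fun _ v (_ : Empty → C) =>
      Φ fun s => {i | θ s i fun k => e i ⁻¹' v k} := by
  have hinj : Function.Injective fun i => e i (m i) := fun i j hij =>
    congrArg Sigma.fst (he.eq_iff.1 hij)
  have hΦ' : Definable (fun _ : Unit => C) fun _ v (x : Empty → C) =>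
      ∃ _ : Unit, x = Empty.elim ∧ Φ fun s => (fun i => e i (m i)) ⁻¹' v s := by
    refine Definable.preimage (T := Unit) (D := fun _ => I) (c := fun _ => Empty.elim)
      (g := fun _ i => e i (m i)) (fun _ _ _ => rfl) ?_ ?_ ?_ ?_ (hΦ.reindex fun _ => ())
    · rintro ⟨_, i⟩ ⟨_, j⟩ hij
      cases hinj hij
      rfl
    · intro _ i j
      by_cases hij : i = j
      · subst hij
        simp
      · exact he.lt_base _ _ _ _ hij
    · exact definable_true.congr fun _ v x => iff_of_true trivial ⟨(), funext fun k => k.elim⟩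
    · refine (definable_mem_const (fun _ => Set.range fun i => e i (m i)) none).congr
        fun _ v x => ?_
      constructor
      · rintro ⟨i, h⟩
        exact ⟨(), i, funext fun k => k.elim, h.symm⟩
      · rintro ⟨_, i, _, h⟩
        exact ⟨i, h.symm⟩
  refine (hΦ'.subst (T := fun s _ v _ => {x | ∃ i, (fun _ : Unit => x) = (fun _ => e i (m i)) ∧
    θ s i fun k => e i ⁻¹' v k}) fun s => ?_).congr fun _ v x => ?_
  · exact (he.definable_fiber hm (hθ s)).rename id fun _ => none
  · have : ∀ s, (fun i => e i (m i)) ⁻¹' {x | ∃ i, (fun _ : Unit => x) = (fun _ => e i (m i)) ∧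
        θ s i fun k => e i ⁻¹' v k} = {i | θ s i fun k => e i ⁻¹' v k} := fun s => by
      ext i
      constructor
      · rintro ⟨j, hj, h⟩
        cases hinj (congrFun hj ())
        exact h
      · intro h
        exact ⟨i, rfl, h⟩
    simp only [this]
    exact ⟨fun ⟨_, _, h⟩ => h, fun h => ⟨(), funext fun k => k.elim, h⟩⟩

/-- A sum has the uniformization property if the summands have it uniformly and the index order has
it for tuples. -/
theorem Unif.lexSum (he : IsLexSum e) {m : ∀ i, M i} (hm : ∀ i a, m i ≤ a)
    (hM : Unif M Unit Unit)
    (hI : ∀ ξ υ : Type, Finite ξ → Finite υ → Unif (fun _ : Unit => I) ξ υ) :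
    Unif (fun _ : Unit => C) Unit Unit := by
  intro S hS htot
  obtain ⟨σ, _, θ, Φ, hθ, hΦ, hdec⟩ := Definable.decomposable he
    (R := fun v : Unit ⊕ Unit → Set C => S () (fun i => v (.inl i)) fun j => v (.inr j)) hS
  have hdec' : ∀ X Y, S () X Y ↔
      Φ fun s => {i | θ s i (Sum.elim (fun k => e i ⁻¹' X k) fun k => e i ⁻¹' Y k)} :=
    fun X Y => by
      refine (hdec (Sum.elim X Y)).trans (iff_of_eq (congrArg Φ ?_))
      funext s
      ext i
      refine iff_of_eq (congrArg (θ s i) ?_)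
      funext o
      cases o <;> rfl
  have hpat : ∀ E : Set σ, DefinableRel M (ξ := Unit) (υ := Unit)
      fun i X Y => ∀ s, θ s i (Sum.elim X Y) ↔ s ∈ E := fun E => by
    refine .forall_finite fun s => .iff ((hθ s).congr fun i v _ => ?_) (definable_prop _)
    refine iff_of_eq (congrArg (θ s i) ?_)
    funext o
    cases o <;> rfl
  -- `χ E` selects in each summand a piece with pattern `E`, if there is one.
  choose χ hχ hχ1 hχ2 using fun E => hM.select (hpat E)
  -- `B` selects in the index order an assignment `U` of patterns that satisfies `Φ` and is
  -- realizable, where `W E` stands for the indices at which pattern `E` is realizable.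
  obtain ⟨B, hB, hB1, hB2⟩ := (hI σ (Set σ) inferInstance inferInstance).select
    (S := fun _ U W => Φ U ∧ ∀ E : Set σ, ∀ i, (∀ s, i ∈ U s ↔ s ∈ E) → i ∈ W E) (by
      refine .and (hΦ.rename Sum.inl id) (.forall_finite fun E => .allPoint ?_)
      exact .imp (.forall_finite fun s => .iff (definable_mem none (Sum.inl s)) (definable_prop _))
        (definable_mem none (Sum.inr E)))
  let W : (Unit → Set C) → Set σ → Set I := fun Y E =>
    {i | ∃ X, ∀ s, θ s i (Sum.elim X fun k => e i ⁻¹' Y k) ↔ s ∈ E}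
  refine ⟨fun _ X Y => ∃ U, B () U (W Y) ∧ ∀ i, ∀ E : Set σ, (∀ s, i ∈ U s ↔ s ∈ E) →
    χ E i (fun k => e i ⁻¹' X k) fun k => e i ⁻¹' Y k, ?_, ?_, ?_⟩
  · have : Definable (fun _ : Unit => C) fun _ (v : Unit ⊕ Unit → Set C) (_ : Empty → C) =>
        ∃ U : σ → Set C, B () (fun s => {i | m i ∈ e i ⁻¹' U s}) (W fun k => v (.inr k)) ∧
          ∀ i, ∀ E : Set σ, (∀ s, m i ∈ e i ⁻¹' U s ↔ s ∈ E) →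
            χ E i (fun k => e i ⁻¹' v (.inl k)) fun k => e i ⁻¹' v (.inr k) := by
      refine Definable.exSets (R := fun _ U (v : Unit ⊕ Unit → Set C) _ =>
        B () (fun s => {i | m i ∈ e i ⁻¹' U s}) (W fun k => v (.inr k)) ∧
          ∀ i, ∀ E : Set σ, (∀ s, m i ∈ e i ⁻¹' U s ↔ s ∈ E) →
            χ E i (fun k => e i ⁻¹' v (.inl k)) fun k => e i ⁻¹' v (.inr k)) ?_
      refine .and ?_ ?_
      · refine he.definable_comp hm (ι := σ ⊕ (Unit ⊕ Unit)) (σ := σ ⊕ Set σ)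
          (θ := Sum.elim (fun s i v => m i ∈ v (.inl s)) fun E i v =>
            ∃ X : Unit → Set (M i), ∀ s, θ s i (Sum.elim X fun k => v (.inr (.inr k))) ↔ s ∈ E)
          (Φ := fun V => B () (fun s => V (.inl s)) fun E => V (.inr E)) ?_ hB
        rintro (s | E)
        · exact definable_const_mem _ _
        · exact (hpat E).exists_left _
      · refine he.definable_comp hm (ι := σ ⊕ (Unit ⊕ Unit)) (σ := Unit)
          (θ := fun _ i v => ∀ E : Set σ, (∀ s, m i ∈ v (.inl s) ↔ s ∈ E) →
            χ E i (fun k => v (.inr (.inl k))) fun k => v (.inr (.inr k)))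
          (Φ := fun V => ∀ i, i ∈ V ()) (fun _ => .forall_finite fun E => .imp
            (.forall_finite fun s => .iff (definable_const_mem _ _) (definable_prop _))
            ((hχ E).definable _ _)) (.allPoint (definable_mem none ()))
    refine this.congr fun _ v _ => ⟨fun ⟨U, hU⟩ => ⟨_, hU⟩, fun ⟨U, hU⟩ => ?_⟩
    -- Subsets of `I` are coded in `C` by least elements; other codes exist, but only the decoded
    -- set is used.
    refine ⟨fun s => {x | ∃ i ∈ U s, e i (m i) = x}, ?_⟩
    have : ∀ s i, m i ∈ e i ⁻¹' {x | ∃ i ∈ U s, e i (m i) = x} ↔ i ∈ U s := fun s i => by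
      constructor
      · rintro ⟨j, hj, h⟩
        cases congrArg Sigma.fst (he.eq_iff.1 h)
        exact hj
      · intro h
        exact ⟨i, h, rfl⟩
    have key : (fun s => {i | m i ∈ e i ⁻¹' {x | ∃ i ∈ U s, e i (m i) = x}}) = U :=
      funext fun s => Set.ext (this s)
    exact ⟨key.symm ▸ hU.1, fun i E hE => hU.2 i E fun s => (this s i).symm.trans (hE s)⟩
  · intro _ Y
    obtain ⟨U, hU, hUu⟩ := hB1 () (W Y)
    choose X hX hXu using fun i => hχ1 {s | i ∈ U s} i fun k => e i ⁻¹' Y k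
    refine ⟨fun _ => {x | ∃ i, ∃ a ∈ X i (), e i a = x}, ⟨U, hU, fun i E hE => ?_⟩, ?_⟩
    · obtain rfl : {s | i ∈ U s} = E := Set.ext hE
      simp only [he.preimage_glue]
      exact hX i
    · rintro X' ⟨U', hU', hX'⟩
      cases hUu _ hU'
      funext k
      refine he.ext_preimage fun i => ?_
      rw [he.preimage_glue]
      exact congrFun (hXu i _ (hX' i _ fun s => Iff.rfl)) k
  · rintro _ X Y ⟨U, hU, hX⟩
    -- An actual solution `X₀` shows that an admissible assignment of patterns exists.
    obtain ⟨hΦU, hW⟩ := hB2 () _ _ hU (by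
      obtain ⟨X₀, hX₀⟩ := htot () Y
      exact ⟨_, (hdec' _ _).1 hX₀, fun E i hE => ⟨_, hE⟩⟩)
    refine (hdec' X Y).2 ?_
    convert hΦU using 1
    funext s
    ext i
    exact hχ2 _ i _ _ (hX i _ fun s => Iff.rfl) (hW _ i fun s => Iff.rfl) s

end LexSum

/-- Uniformization in a sum of copies of `M` gives uniformization for tuples in the index order, the
tuples being coded by points of the copies. -/
theorem Unif.of_lexSum_const {I M C : Type*} [PartialOrder I] [PartialOrder M] [PartialOrder C]
    {e : I → M → C} (he : IsLexSum (M := fun _ => M) e) {υ : Type} [Finite υ] {r : Option υ → M}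
    (hr : Function.Injective r) (hr0 : ∀ a, r none ≤ a) (h : Unif (fun _ : Unit => C) Unit Unit) :
    Unif (fun _ : Unit => I) Unit υ := by
  intro S hS htot
  let encX : Set I → Set C := fun X => {x | ∃ i, ∃ a ∈ {a | a = r none ∧ i ∈ X}, e i a = x}
  let encY : (υ → Set I) → Set C := fun Y =>
    {x | ∃ i, ∃ a ∈ {a | ∃ j, a = r (some j) ∧ i ∈ Y j}, e i a = x}
  have hencX : ∀ X i, e i ⁻¹' encX X = {a | a = r none ∧ i ∈ X} := fun X => he.preimage_glue _
  have hencY : ∀ Y i, e i ⁻¹' encY Y = {a | ∃ j, a = r (some j) ∧ i ∈ Y j} :=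
    fun Y => he.preimage_glue _
  have hdecX : ∀ X, {i | r none ∈ e i ⁻¹' encX X} = X := fun X => by
    ext i
    simp [hencX]
  have hdecY : ∀ Y j, {i | r (some j) ∈ e i ⁻¹' encY Y} = Y j := fun Y j => by
    ext i
    simp [hencY, hr.eq_iff]
  have hsub : ∀ X, encX X ⊆ Set.range fun i => e i (r none) := by
    rintro X _ ⟨i, _, ⟨rfl, _⟩, rfl⟩
    exact ⟨i, rfl⟩
  have hencdec : ∀ X : Set C, X ⊆ (Set.range fun i => e i (r none)) →
      encX {i | r none ∈ e i ⁻¹' X} = X := fun X hX => by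
    refine he.ext_preimage fun i => ?_
    rw [hencX]
    ext a
    constructor
    · rintro ⟨rfl, h⟩
      exact h
    · intro ha
      obtain ⟨j, hj⟩ := hX ha
      cases he.eq_iff.1 hj
      exact ⟨rfl, ha⟩
  -- Confining `X` to the least elements makes its code unique, so that uniqueness survives
  -- decoding.
  obtain ⟨T, hT, hT1, hT2⟩ := h (fun _ X Y =>
    S () (fun _ => {i | r none ∈ e i ⁻¹' X ()}) (fun j => {i | r (some j) ∈ e i ⁻¹' Y ()}) ∧
      ∀ x, x ∈ X () → x ∈ Set.range fun i => e i (r none)) (by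
      refine .and ?_ (.allPoint (.imp (definable_mem none (Sum.inl ()))
        (definable_mem_const _ none)))
      refine he.definable_comp (fun _ => hr0) (ι := Unit ⊕ Unit) (σ := Unit ⊕ υ)
        (θ := Sum.elim (fun _ i v => r none ∈ v (.inl ())) fun j i v => r (some j) ∈ v (.inr ()))
        (Φ := fun V => S () (fun s => V (.inl s)) fun j => V (.inr j)) ?_ hS
      rintro (_ | j)
      · exact definable_const_mem (fun _ => r none) _
      · exact definable_const_mem (fun _ => r (some j)) _) fun _ Y => by
      obtain ⟨X, hX⟩ := htot () fun j => {i | r (some j) ∈ e i ⁻¹' Y ()}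
      refine ⟨fun _ => encX (X ()), ?_, hsub _⟩
      rw [hdecX]
      exact hX
  obtain ⟨σ, _, θ, Φ, hθ, hΦ, hdec⟩ := Definable.decomposable he
    (R := fun v : Unit ⊕ Unit → Set C => T () (fun i => v (.inl i)) fun j => v (.inr j)) hT
  refine ⟨fun _ X Y => T () (fun _ => encX (X ())) fun _ => encY Y, ?_, fun _ Y => ?_, ?_⟩
  · let pat : Set (Option υ) → Unit ⊕ Unit → Set M := fun p =>
      Sum.elim (fun _ => {a | a = r none ∧ none ∈ p})
        fun _ => {a | ∃ j, a = r (some j) ∧ some j ∈ p}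
    -- On copy `i` the coded sets depend only on which of the given sets contain `i`. There are
    -- finitely many such patterns `p`, and for each the set of `i` where `θ s i (pat p)` holds is a
    -- parameter of `I`.
    refine (hΦ.subst (T := fun s _ (v : Unit ⊕ υ → Set I) _ =>
      {i | θ s i (pat {o | i ∈ v (o.elim (.inl ()) .inr)})}) fun s => ?_).congr fun _ v _ => ?_
    · refine (Definable.forall_finite fun p : Set (Option υ) => .imp
        (.forall_finite fun o : Option υ => .iff (definable_mem none (o.elim (.inl ()) .inr))
          (definable_prop (o ∈ p))) (definable_mem_const (fun _ => {i | θ s i (pat p)}) none)).congr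
        fun _ v x => ?_
      constructor
      · intro h
        exact h _ fun o => Iff.rfl
      · intro h p hp
        obtain rfl : {o : Option υ | x none ∈ v (o.elim (.inl ()) .inr)} = p := Set.ext hp
        exact h
    · refine Iff.trans ?_ (hdec (Sum.elim (fun _ => encX (v (.inl ())))
        fun _ => encY fun j => v (.inr j))).symm
      refine iff_of_eq (congrArg Φ ?_)
      funext s
      ext i
      refine iff_of_eq (congrArg (θ s i) ?_)
      funext o
      rcases o with _ | _
      · exact (hencX _ i).symm
      · exact (hencY _ i).symm
  · obtain ⟨X, hX, hu⟩ := hT1 () fun _ => encY Y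
    have hX' := (hT2 _ _ _ hX).2
    refine ⟨fun _ => {i | r none ∈ e i ⁻¹' X ()}, ?_, fun X' hX' => ?_⟩
    · simpa only [hencdec _ hX'] using hX
    · funext _
      rw [← hu _ hX', hdecX]
  · intro _ X Y hX
    have := (hT2 _ _ _ hX).1
    simpa only [hdecX, hdecY] using this

/-! ### Sums and products of ordinals -/

open Ordinal

theorem exists_isLexSum_mul (α β : Ordinal.{u}) :
    ∃ e : β.ToType → α.ToType → (α * β).ToType, IsLexSum (M := fun _ => α.ToType) e := by
  have h : type (Prod.Lex ((· < ·) : β.ToType → β.ToType → Prop)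
      ((· < ·) : α.ToType → α.ToType → Prop)) = typeLT (α * β).ToType := by
    rw [type_prod_lex, type_toType, type_toType, type_toType]
  obtain ⟨f⟩ := type_eq.1 h
  have hlt : ∀ i j a b, f (i, a) < f (j, b) ↔ i < j ∨ i = j ∧ a < b := fun i j a b =>
    f.map_rel_iff.trans Prod.lex_def
  refine ⟨fun i a => f (i, a), ⟨?_, ?_⟩, fun i a b => ?_, fun i j a b hij => ?_⟩
  · rintro ⟨i, a⟩ ⟨j, b⟩ h
    cases f.injective h
    rfl
  · intro x
    exact ⟨⟨(f.symm x).1, (f.symm x).2⟩, f.apply_symm_apply x⟩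
  · simp [hlt]
  · simp [hlt, hij]

theorem exists_isLexSum_add (α β : Ordinal.{u}) :
    ∃ e : ∀ b : Bool, (bif b then β else α).ToType → (α + β).ToType, IsLexSum e := by
  have h : type (Sum.Lex ((· < ·) : α.ToType → α.ToType → Prop)
      ((· < ·) : β.ToType → β.ToType → Prop)) = typeLT (α + β).ToType := by
    rw [type_sum_lex, type_toType, type_toType, type_toType]
  obtain ⟨f⟩ := type_eq.1 h
  refine ⟨fun b => match b with
    | false => fun a => f (.inl a)
    | true => fun a => f (.inr a), ⟨?_, ?_⟩, ?_, ?_⟩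
  · rintro ⟨_ | _, a⟩ ⟨_ | _, b⟩ h <;> cases f.injective h <;> rfl
  · intro x
    obtain ⟨a | a, rfl⟩ := f.surjective x
    · exact ⟨⟨false, a⟩, rfl⟩
    · exact ⟨⟨true, a⟩, rfl⟩
  · rintro (_ | _) a b
    · exact f.map_rel_iff.trans Sum.lex_inl_inl
    · exact f.map_rel_iff.trans Sum.lex_inr_inr
  · rintro (_ | _) (_ | _) a b hij
    · exact absurd rfl hij
    · exact f.map_rel_iff.trans (iff_of_true (Sum.Lex.sep _ _) (by decide))
    · exact f.map_rel_iff.trans (iff_of_false Sum.lex_inr_inl (by decide))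
    · exact absurd rfl hij

theorem exists_forall_le_toType {α : Ordinal.{u}} (h : α ≠ 0) :
    ∃ m : α.ToType, ∀ a, m ≤ a :=
  have := nonempty_toType_iff.2 h
  letI := WellFoundedLT.toOrderBot α.ToType
  ⟨⊥, fun _ => bot_le⟩

theorem HasUniformizationProperty.add {α β : Ordinal.{u}}
    (hα : HasUniformizationProperty α.ToType) (hβ : HasUniformizationProperty β.ToType) :
    HasUniformizationProperty (α + β).ToType := by
  rcases eq_or_ne α 0 with rfl | hα0
  · rwa [zero_add]
  rcases eq_or_ne β 0 with rfl | hβ0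
  · rwa [add_zero]
  obtain ⟨e, he⟩ := exists_isLexSum_add α β
  have hne : ∀ b : Bool, (bif b then β else α) ≠ 0 := by
    rintro (_ | _)
    · exact hα0
    · exact hβ0
  choose m hm using fun b => exists_forall_le_toType (hne b)
  have (b : Bool) : Nonempty (bif b then β else α).ToType := ⟨m b⟩
  refine (Unif.lexSum he hm (unif_of_forall (Equiv.refl Bool) ?_)
    fun ξ υ _ _ => unif_of_finite ξ υ).hasUniformizationProperty
  rintro (_ | _)
  · exact hα.unif
  · exact hβ.unif

theorem finite_natCast_toType (n : ℕ) : Finite (n : Ordinal.{u}).ToType := by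
  rw [← Cardinal.mk_lt_aleph0_iff, Cardinal.mk_toType, card_nat]
  exact Cardinal.natCast_lt_aleph0

theorem exists_natCast_succ_mul_eq (k : ℕ) (β : Ordinal.{u}) :
    ∃ m : ℕ, ((k + 1 : ℕ) : Ordinal.{u}) * β = β + m := by
  obtain ⟨m, hm⟩ := lt_omega0.1 (mod_lt β omega0_ne_zero)
  -- With `β = ω * q + m` and `(k + 1) * ω = ω`, the left side is `ω * q + (k + 1) * m`, that is, `β
  -- + k * m`.
  refine ⟨k * m, ?_⟩
  conv_lhs => rw [← div_add_mod β ω]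
  conv_rhs => rw [← div_add_mod β ω]
  rw [mul_add, ← mul_assoc, natCast_mul_omega0 k.succ_pos, hm, add_assoc]
  congr 1
  norm_cast
  ring

theorem HasUniformizationProperty.natCast_succ_mul {β : Ordinal.{u}}
    (hβ : HasUniformizationProperty β.ToType) (k : ℕ) :
    HasUniformizationProperty (((k + 1 : ℕ) : Ordinal.{u}) * β).ToType := by
  obtain ⟨m, hm⟩ := exists_natCast_succ_mul_eq k β
  rw [hm]
  have := finite_natCast_toType.{u} m
  exact hβ.add (unif_of_finite Unit Unit).hasUniformizationProperty

/-- For ordinals, uniformization with a single set variable implies uniformization for tuples,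
because `k * β` is the sum of `β` and a finite ordinal. -/
theorem HasUniformizationProperty.unif_tuple {β : Ordinal.{u}}
    (hβ : HasUniformizationProperty β.ToType) (ξ υ : Type) [Finite ξ] [Finite υ] :
    Unif (fun _ : Unit => β.ToType) ξ υ := by
  refine Unif.tuple (fun υ _ => ?_) ξ υ
  obtain ⟨k, ⟨f⟩⟩ := Finite.exists_equiv_fin υ
  -- Each copy of `k + 1` has its least point for the output set and `k` points for the inputs.
  obtain ⟨e, he⟩ := exists_isLexSum_mul ((k + 1 : ℕ) : Ordinal.{u}) β
  have := finite_natCast_toType.{u} (k + 1)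
  have := Fintype.ofFinite ((k + 1 : ℕ) : Ordinal.{u}).ToType
  let g := Fintype.orderIsoFinOfCardEq ((k + 1 : ℕ) : Ordinal.{u}).ToType (k := k + 1) (by
    rw [← Nat.card_eq_fintype_card, Nat.card, Cardinal.mk_toType, card_nat,
      Cardinal.toNat_natCast])
  have hr : Function.Injective fun o : Option υ => g (o.elim 0 fun j => (f j).succ) := by
    rintro (_ | i) (_ | j) h
    · rfl
    · exact absurd (g.injective h) (Fin.succ_ne_zero _).symm
    · exact absurd (g.injective h) (Fin.succ_ne_zero _)
    · simpa using h
  refine Unif.of_lexSum_const he hr (fun a => ?_) (hβ.natCast_succ_mul k).unif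
  obtain ⟨i, rfl⟩ := g.surjective a
  exact g.monotone (Fin.zero_le i)

theorem HasUniformizationProperty.mul {α β : Ordinal.{u}}
    (hα : HasUniformizationProperty α.ToType) (hβ : HasUniformizationProperty β.ToType) :
    HasUniformizationProperty (α * β).ToType := by
  -- Only the summands need least elements, so an empty index order `β` is no exception.
  rcases eq_or_ne α 0 with rfl | hα0
  · rwa [zero_mul]
  obtain ⟨e, he⟩ := exists_isLexSum_mul α β
  obtain ⟨m, hm⟩ := exists_forall_le_toType hα0
  exact (Unif.lexSum he (fun _ => hm) (unif_const fun υ _ => hα.unif_tuple Unit υ)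
    fun ξ υ _ _ => hβ.unif_tuple ξ υ).hasUniformizationProperty

end MonadicOrder

theorem proposition6p1 (α β : Ordinal.{u})
    (hα : MonadicOrder.HasUniformizationProperty α.ToType)
    (hβ : MonadicOrder.HasUniformizationProperty β.ToType) :
    MonadicOrder.HasUniformizationProperty (α + β).ToType ∧
      MonadicOrder.HasUniformizationProperty (α * β).ToType :=
  ⟨hα.add hβ, hα.mul hβ⟩
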